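/- All graphs are finite and simple. A $k$-coloring of $G$ is a proper vertex coloring with colors from a set of $k$ colors. A $2$-dynamic $k$-coloring is a $k$-coloring in which the neighbors of every vertex $v$ receive at least $\min\{2,\deg(v)\}$ different colors, and $\chi_2(G)$ is the least $k$ for which $G$ has a $2$-dynamic $k$-coloring. For a coloring $c$ of $G$, let $B_c$ be the set of vertices $v$ with $\deg(v)\ge 2$ all of whose neighbors receive one and the same color under $c$. Let $G^2$ be the graph on $V(G)$ in which two distinct vertices are adjacent if and only if their distance in $G$ is at most $2$, and let $G^2[B_c]\setminus E(G)$ be the subgraph of $G^2$ induced on $B_c$ with all edges of $G$ deleted. **Theorem.** Let $G$ be a $d$-regular graph. For every $k$ and every $k$-coloring $c$ of $G$, $$\chi_2(G)\le k+2\,\chi\bigl(G^2[B_c]\setminus E(G)\bigr).$$ Therefore $$\chi_2(G)\le \min\bigl\{k+2\,\chi(G^2[B_c]\setminus E(G)) : k\in\mathbb{N},\ c \text{ is a } k\text{-coloring of } G\bigr\}.$$ -/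

import Mathlib

namespace SimpleGraph

/-- A proper coloring `c` of `G` is `r`-dynamic if every vertex `v` sees at least `min r (deg v)`
different colors among its neighbors. -/
def IsDynamicColoring {V α : Type*} {G : SimpleGraph V} (r : ℕ) (c : G.Coloring α) : Prop :=
  ∀ v : V, min (r : ℕ∞) (G.neighborSet v).encard ≤ (c '' G.neighborSet v).encard

/-- `G` admits an `r`-dynamic coloring with (at most) `k` colors. -/
def DynamicColorable {V : Type*} (G : SimpleGraph V) (r k : ℕ) : Prop :=
  ∃ c : G.Coloring (Fin k), IsDynamicColoring r c

/-- The `r`-dynamic chromatic number `χ_r(G)`: the least `k` such that `G` has an `r`-dynamic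
`k`-coloring (and `⊤` if there is none), in the style of `SimpleGraph.chromaticNumber`. -/
noncomputable def dynamicChromaticNumber {V : Type*} (G : SimpleGraph V) (r : ℕ) : ℕ∞ :=
  ⨅ k ∈ {k : ℕ | G.DynamicColorable r k}, (k : ℕ∞)

/-- The set `B_c` of bad vertices of a coloring `c`: the vertices of degree at least two whose
neighbors all receive the same color. -/
def badVertices {V α : Type*} {G : SimpleGraph V} (c : G.Coloring α) : Set V :=
  {v | 2 ≤ (G.neighborSet v).encard ∧ (c '' G.neighborSet v).encard = 1}

/-- The square `G²` of `G`: distinct vertices are adjacent iff their distance in `G` is at most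
two. -/
def square {V : Type*} (G : SimpleGraph V) : SimpleGraph V where
  Adj u v := u ≠ v ∧ (G.Adj u v ∨ ∃ w, G.Adj u w ∧ G.Adj w v)
  symm := ⟨fun _ _ h => ⟨h.1.symm, h.2.imp (·.symm) fun ⟨w, h₁, h₂⟩ => ⟨w, h₂.symm, h₁.symm⟩⟩⟩
  loopless := ⟨fun _ h => h.1 rfl⟩

/-- The graph `G²[B] ∖ E(G)`: the subgraph of `G²` induced on `B`, with the edges of `G` deleted. -/
def squareInduceDiff {V : Type*} (G : SimpleGraph V) (B : Set V) : SimpleGraph B :=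
  G.square.induce B \ G.induce B

end SimpleGraph

/-! For `d ≥ 2`, the color classes of `G²[B_c] ∖ E(G)` are repaired one at a time, each at the price
of two new colors. Two bad vertices with a common neighbor cannot be adjacent in `G`, since that
neighbor and one of the two would share a color along an edge. Hence vertices of one class have
pairwise disjoint neighborhoods. For each `v` in a class `I`, recolor one neighbor outside `I` with
a new color. Properness and the absence of new bad vertices are encoded as non-adjacency in an
auxiliary graph on pairs (vertex, new color). Its maximum degree is at most `d - 1`, and each `v`
offers at least `2(d - 1)` pairs, exactly what Haxell's theorem needs for a consistent choice. -/

namespace SimpleGraph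

/-! ### Independent transversals -/

/-- `t` picks a vertex from each part `P i`, `i ∈ J`, and the chosen vertices are pairwise
non-adjacent. -/
def IsIndepTransversal {W ι : Type*} (H : SimpleGraph W) (J : Finset ι) (P : ι → Set W)
    (t : ι → W) : Prop :=
  (∀ i ∈ J, t i ∈ P i) ∧ ∀ i ∈ J, ∀ j ∈ J, i ≠ j → ¬ H.Adj (t i) (t j)

theorem IsIndepTransversal.anti {W ι : Type*} {H K : SimpleGraph W} {J : Finset ι}
    {P : ι → Set W} {t : ι → W} (h : H.IsIndepTransversal J P t) (hK : K ≤ H) :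
    K.IsIndepTransversal J P t :=
  ⟨h.1, fun i hi j hj hij hadj => h.2 i hi j hj hij (hK hadj)⟩

/-- Haxell: if all parts but `P a` have an independent transversal and all parts together have
none, then some subfamily of parts containing `P a` is totally dominated by few vertices. -/
theorem exists_dominating_of_no_indepTransversal {W ι : Type*} [Finite W] [DecidableEq ι]
    [DecidableEq W] (n : ℕ) :
    ∀ (H : SimpleGraph W) (J : Finset ι) (P : ι → Set W) (a : ι), J.card = n → a ∈ J →
      (∀ i ∈ J, ∀ j ∈ J, ∀ w, w ∈ P i → w ∈ P j → i = j) →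
      (∃ t, H.IsIndepTransversal (J.erase a) P t) → (¬ ∃ t, H.IsIndepTransversal J P t) →
      ∃ S ⊆ J, a ∈ S ∧ ∃ D : Finset W, D.card + 2 ≤ 2 * S.card ∧
        ∀ i ∈ S, ∀ w ∈ P i, ∃ x ∈ D, H.Adj x w := by
  induction n with
  | zero =>
    intro H J P a hJ ha
    simp [Finset.card_eq_zero.mp hJ] at ha
  | succ n ih =>
  intro H
  induction H using WellFoundedLT.induction with
  | ind H ihH =>
  intro J P a hJ ha hdisj ⟨t, ht⟩ hno
  -- Domination in a subgraph persists in `H`, so by induction on `H` every edge meeting `P a` may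
  -- be assumed critical: deleting it creates a transversal.
  by_cases hred : ∃ x ∈ P a, ∃ y, H.Adj x y ∧
      ¬ ∃ t, (H.deleteEdges {s(x, y)}).IsIndepTransversal J P t
  · obtain ⟨x, -, y, hxy, hno'⟩ := hred
    have hle : H.deleteEdges {s(x, y)} ≤ H := deleteEdges_le _
    have hlt : H.deleteEdges {s(x, y)} < H := by
      refine lt_of_le_of_ne hle fun he => ?_
      rw [← he] at hxy
      simp at hxy
    obtain ⟨S, hS, haS, D, hD, hdom⟩ := ihH _ hlt J P a hJ ha hdisj ⟨t, ht.anti hle⟩ hno'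
    refine ⟨S, hS, haS, D, hD, fun i hi w hw => ?_⟩
    obtain ⟨x, hx, hxw⟩ := hdom i hi w hw
    exact ⟨x, hx, hle hxw⟩
  push Not at hred
  rcases (P a).eq_empty_or_nonempty with hempty | ⟨v, hv⟩
  · refine ⟨{a}, by simpa using ha, by simp, ∅, by simp, fun i hi w hw => ?_⟩
    rw [Finset.mem_singleton.mp hi, hempty] at hw
    exact hw.elim
  -- Otherwise `v` would extend the partial transversal `t`.
  obtain ⟨z, hz⟩ : ∃ z, H.Adj v z := by
    by_contra! hv'
    refine hno ⟨Function.update t a v, fun i hi => ?_, fun i hi j hj hij => ?_⟩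
    · by_cases h : i = a
      · subst h; simpa using hv
      · simpa [h] using ht.1 i (by simp [h, hi])
    · by_cases h : i = a
      · subst h; simpa using hv' _
      · by_cases h' : j = a
        · subst h'; simpa [h] using fun hh => hv' _ hh.symm
        · simpa [h, h'] using ht.2 i (by simp [h, hi]) j (by simp [h', hj]) hij
  obtain ⟨s, hs⟩ := hred v hv z hz
  -- the transversal `s` must use both ends of the deleted edge
  obtain ⟨b, hb, hba, hsab, hsv⟩ : ∃ b ∈ J, b ≠ a ∧ H.Adj (s a) (s b) ∧
      ∀ i ∈ J, ∀ j ∈ J, i ≠ j → H.Adj (s i) (s j) → i = a ∧ j = b ∨ i = b ∧ j = a := by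
    have key : ∀ i ∈ J, ∀ j ∈ J, i ≠ j → H.Adj (s i) (s j) →
        s i = v ∧ s j = z ∨ s i = z ∧ s j = v := by
      intro i hi j hj hij hadj
      have := hs.2 i hi j hj hij
      simp only [deleteEdges_adj, hadj, true_and, not_not, Set.mem_singleton_iff] at this
      simpa using this
    have hva : ∀ i ∈ J, s i = v → i = a := fun i hi h =>
      hdisj i hi a ha v (h ▸ hs.1 i hi) hv
    obtain ⟨i, hi, j, hj, hij, hadj⟩ :
        ∃ i ∈ J, ∃ j ∈ J, i ≠ j ∧ H.Adj (s i) (s j) := by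
      by_contra! hcon
      exact hno ⟨s, hs.1, hcon⟩
    have main : ∃ b ∈ J, b ≠ a ∧ s a = v ∧ s b = z := by
      rcases key i hi j hj hij hadj with ⟨h1, h2⟩ | ⟨h1, h2⟩
      · have := hva i hi h1
        subst this
        exact ⟨j, hj, hij.symm, h1, h2⟩
      · have := hva j hj h2
        subst this
        exact ⟨i, hi, hij, h2, h1⟩
    obtain ⟨b, hb, hba, hav, hbz⟩ := main
    have hzb : ∀ i ∈ J, s i = z → i = b := fun i hi h =>
      hdisj i hi b hb z (h ▸ hs.1 i hi) (hbz ▸ hs.1 b hb)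
    refine ⟨b, hb, hba, by rw [hav, hbz]; exact hz, fun i hi j hj hij hadj => ?_⟩
    rcases key i hi j hj hij hadj with ⟨h1, h2⟩ | ⟨h1, h2⟩
    · exact Or.inl ⟨hva i hi h1, hzb j hj h2⟩
    · exact Or.inr ⟨hzb i hi h1, hva j hj h2⟩
  -- merge the parts `P a` and `P b` and remove what `s a` and `s b` dominate
  let Q : ι → Set W := fun i =>
    {w | (w ∈ P i ∨ i = a ∧ w ∈ P b) ∧ ¬ H.Adj (s a) w ∧ ¬ H.Adj (s b) w}
  obtain ⟨S, hS, haS, D, hD, hdom⟩ := ih H (J.erase b) Q a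
    (by rw [Finset.card_erase_of_mem hb, hJ]; rfl) (by simp [hba.symm, ha])
    (by
      intro i hi j hj w hwi hwj
      simp only [Finset.mem_erase] at hi hj
      rcases hwi.1 with h1 | ⟨h1, h1'⟩ <;> rcases hwj.1 with h2 | ⟨h2, h2'⟩
      · exact hdisj i hi.2 j hj.2 w h1 h2
      · exact (hi.1 (hdisj i hi.2 b hb w h1 h2')).elim
      · exact (hj.1 (hdisj j hj.2 b hb w h2 h1')).elim
      · rw [h1, h2])
    (by
      refine ⟨s, fun i hi => ?_, fun i hi j hj hij hadj => ?_⟩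
      · simp only [Finset.mem_erase] at hi
        refine ⟨Or.inl (hs.1 i hi.2.2), fun h => ?_, fun h => ?_⟩
        · rcases hsv a ha i hi.2.2 hi.1.symm h with h | h
          · exact hi.2.1 h.2
          · exact hba h.1.symm
        · rcases hsv b hb i hi.2.2 (Ne.symm hi.2.1) h with h | h
          · exact hba h.1
          · exact hi.1 h.2
      · simp only [Finset.mem_erase] at hi hj
        rcases hsv i hi.2.2 j hj.2.2 hij hadj with h | h
        · exact hi.1 h.1
        · exact hi.2.1 h.1)
    (by
      rintro ⟨u, hu⟩
      have huQ : ∀ i ∈ J, i ≠ b → u i ∈ Q i := fun i hi hib => hu.1 i (by simp [hi, hib])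
      have huI : ∀ i ∈ J, i ≠ b → ∀ j ∈ J, j ≠ b → i ≠ j → ¬ H.Adj (u i) (u j) :=
        fun i hi hib j hj hjb => hu.2 i (by simp [hi, hib]) j (by simp [hj, hjb])
      have huP : ∀ i ∈ J, i ≠ b → i ≠ a → u i ∈ P i := fun i hi hib hia => by
        simpa [hia] using (huQ i hi hib).1
      -- The representative `u a` of the merged part serves whichever of `P a`, `P b` contains it;
      -- `s b` or `s a` fills the other, and is non-adjacent to every `u i` by the choice of `Q`.
      rcases (huQ a ha hba.symm).1 with h | ⟨-, h⟩
      · refine hno ⟨Function.update u b (s b), fun i hi => ?_, fun i hi j hj hij => ?_⟩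
        · by_cases hib : i = b
          · subst hib; simpa using hs.1 i hi
          · by_cases hia : i = a
            · subst hia; simpa [hib] using h
            · simpa [hib] using huP i hi hib hia
        · by_cases hib : i = b
          · subst hib; simpa [Ne.symm hij] using (huQ j hj (Ne.symm hij)).2.2
          · by_cases hjb : j = b
            · subst hjb
              simpa [hij] using fun hh => (huQ i hi hij).2.2 hh.symm
            · simpa [hib, hjb] using huI i hi hib j hj hjb hij
      · refine hno ⟨Function.update (Function.update u b (u a)) a (s a), fun i hi => ?_,
          fun i hi j hj hij => ?_⟩
        · by_cases hia : i = a
          · subst hia; simpa using hs.1 i hi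
          · by_cases hib : i = b
            · subst hib; simpa [hia] using h
            · simpa [hia, hib] using huP i hi hib hia
        · have hQ : ∀ i ∈ J, i ≠ a → ¬ H.Adj (s a) (Function.update u b (u a) i) := by
            intro i hi hia
            by_cases hib : i = b
            · subst hib; simpa using (huQ a ha (Ne.symm hia)).2.1
            · simpa [hib] using (huQ i hi hib).2.1
          by_cases hia : i = a
          · subst hia; simpa [Ne.symm hij] using hQ j hj (Ne.symm hij)
          · by_cases hja : j = a
            · subst hja
              simpa [hij] using fun hh => hQ i hi hij hh.symm
            · by_cases hib : i = b
              · subst hib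
                simpa [hia, hja, Ne.symm hij] using
                  huI a ha (Ne.symm hia) j hj (Ne.symm hij) (Ne.symm hja)
              · by_cases hjb : j = b
                · subst hjb
                  simpa [hia, hja, hij] using huI i hi hij a ha (Ne.symm hja) hia
                · simpa [hia, hja, hib, hjb] using huI i hi hib j hj hjb hij)
  have hbS : b ∉ S := fun h => by simpa using hS h
  refine ⟨insert b S, ?_, by simp [haS], insert (s a) (insert (s b) D), ?_, ?_⟩
  · intro i hi
    rcases Finset.mem_insert.mp hi with rfl | hi
    · exact hb
    · exact Finset.mem_of_mem_erase (hS hi)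
  · rw [Finset.card_insert_of_notMem hbS]
    have h1 := Finset.card_insert_le (s a) (insert (s b) D)
    have h2 := Finset.card_insert_le (s b) D
    omega
  · intro i hi w hw
    by_cases h1 : H.Adj (s a) w
    · exact ⟨s a, by simp, h1⟩
    by_cases h2 : H.Adj (s b) w
    · exact ⟨s b, by simp, h2⟩
    obtain ⟨x, hx, hxw⟩ : ∃ x ∈ D, H.Adj x w := by
      rcases Finset.mem_insert.mp hi with rfl | hi
      · exact hdom a haS w ⟨Or.inr ⟨rfl, hw⟩, h1, h2⟩
      · exact hdom i hi w ⟨Or.inl hw, h1, h2⟩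
    exact ⟨x, by simp [hx], hxw⟩

/-- Haxell's theorem: disjoint parts of size at least `2Δ` in a graph of maximum degree at most
`Δ` have an independent transversal. -/
theorem exists_indepTransversal {W ι : Type*} [Finite W] (H : SimpleGraph W) (Δ : ℕ)
    (hΔ : 0 < Δ) (hdeg : ∀ w, (H.neighborSet w).ncard ≤ Δ) (J : Finset ι) (P : ι → Set W)
    (hdisj : ∀ i ∈ J, ∀ j ∈ J, ∀ w, w ∈ P i → w ∈ P j → i = j)
    (hP : ∀ i ∈ J, 2 * Δ ≤ (P i).ncard) (t₀ : ι → W) :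
    ∃ t, H.IsIndepTransversal J P t := by
  classical
  have := Fintype.ofFinite W
  induction J using Finset.induction_on with
  | empty => exact ⟨t₀, by simp, by simp⟩
  | insert a J ha ih =>
    have hJ := ih (fun i hi j hj => hdisj i (by simp [hi]) j (by simp [hj]))
      (fun i hi => hP i (by simp [hi]))
    by_contra hno
    obtain ⟨S, hS, haS, D, hD, hdom⟩ := exists_dominating_of_no_indepTransversal _ H
      (insert a J) P a rfl (by simp) hdisj (by rwa [Finset.erase_insert ha]) hno
    -- Counting: the parts in `S` hold at least `2Δ|S|` vertices, but `D` dominates at most `(2|S| -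
    -- 2)Δ`.
    have h1 : S.card * (2 * Δ) ≤ (S.biUnion fun i => (P i).toFinset).card := by
      rw [Finset.card_biUnion]
      · rw [← smul_eq_mul]
        refine Finset.card_nsmul_le_sum _ _ _ fun i hi => ?_
        rw [← Set.ncard_eq_toFinset_card']
        exact hP i (hS hi)
      · intro i hi j hj hij
        rw [Function.onFun, Finset.disjoint_left]
        intro w hwi hwj
        exact hij (hdisj i (hS hi) j (hS hj) w (by simpa using hwi) (by simpa using hwj))
    have h2 : (S.biUnion fun i => (P i).toFinset) ⊆
        D.biUnion fun x => (H.neighborSet x).toFinset := by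
      intro w hw
      simp only [Finset.mem_biUnion, Set.mem_toFinset] at hw
      obtain ⟨i, hi, hw⟩ := hw
      obtain ⟨x, hx, hxw⟩ := hdom i hi w hw
      simp only [Finset.mem_biUnion, Set.mem_toFinset]
      exact ⟨x, hx, hxw⟩
    have h3 : (D.biUnion fun x => (H.neighborSet x).toFinset).card ≤ D.card * Δ :=
      Finset.card_biUnion_le_card_mul _ _ _ fun x _ => by
        rw [← Set.ncard_eq_toFinset_card']
        exact hdeg x
    have h4 := (h1.trans (Finset.card_le_card h2)).trans h3
    have h5 := Nat.mul_le_mul_right Δ hD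
    nlinarith

/-! ### Bad vertices and 2-dynamic colorings -/

theorem mem_badVertices_iff {V α : Type*} {G : SimpleGraph V} (c : G.Coloring α) (v : V) :
    v ∈ badVertices c ↔ 2 ≤ (G.neighborSet v).encard ∧
      ∀ x y, G.Adj v x → G.Adj v y → c x = c y := by
  refine and_congr_right fun h => ?_
  rw [Set.encard_eq_one]
  constructor
  · rintro ⟨a, ha⟩ x y hx hy
    have h1 : c x ∈ c '' G.neighborSet v := ⟨x, hx, rfl⟩
    have h2 : c y ∈ c '' G.neighborSet v := ⟨y, hy, rfl⟩
    rw [ha] at h1 h2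
    rw [h1, h2]
  · intro hc
    obtain ⟨x, hx⟩ : (G.neighborSet v).Nonempty := by
      rw [← Set.encard_pos]
      exact lt_of_lt_of_le (by norm_num) h
    refine ⟨c x, Set.eq_singleton_iff_unique_mem.mpr ⟨⟨x, hx, rfl⟩, ?_⟩⟩
    rintro _ ⟨y, hy, rfl⟩
    exact hc y x hy hx

theorem isDynamicColoring_two_of_badVertices_eq_empty {V α : Type*} {G : SimpleGraph V}
    (c : G.Coloring α) (h : badVertices c = ∅) : IsDynamicColoring 2 c := by
  intro v
  by_cases h2 : 2 ≤ (G.neighborSet v).encard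
  · refine (min_le_left _ _).trans ?_
    have hne : (c '' G.neighborSet v).encard ≠ 1 := fun h1 => by
      have : v ∈ badVertices c := ⟨h2, h1⟩
      simp [h] at this
    have hpos : 1 ≤ (c '' G.neighborSet v).encard := by
      rw [Set.one_le_encard_iff_nonempty, Set.image_nonempty, ← Set.encard_pos]
      exact lt_of_lt_of_le (by norm_num) h2
    have := Order.add_one_le_of_lt (lt_of_le_of_ne hpos (Ne.symm hne))
    simpa [one_add_one_eq_two] using this
  · refine (min_le_right _ _).trans ?_
    have hle : (G.neighborSet v).encard ≤ 1 :=
      Order.le_of_lt_add_one (by simpa [one_add_one_eq_two] using h2)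
    rw [Set.InjOn.encard_image]
    exact fun x hx y hy _ => Set.encard_le_one_iff.mp hle x y hx hy

/-! ### Repairing one class with two new colors -/

/-- In a `d`-regular graph with `d ≥ 2`, two new colors suffice to repair a set `I` of bad vertices
with pairwise disjoint neighborhoods, without creating new bad vertices. -/
theorem exists_coloring_badVertices_subset_diff {V α : Type*} [Finite V] {G : SimpleGraph V}
    {d : ℕ} (hd : 2 ≤ d) (hG : ∀ v, (G.neighborSet v).ncard = d) (c : G.Coloring α) (I : Set V)
    (hI : ∀ u ∈ I, ∀ v ∈ I, ∀ w, G.Adj u w → G.Adj v w → u = v) :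
    ∃ c' : G.Coloring (α ⊕ Bool), badVertices c' ⊆ badVertices c \ I := by
  classical
  have := Fintype.ofFinite V
  rcases isEmpty_or_nonempty V with hV | ⟨⟨v₀⟩⟩
  · exact ⟨⟨fun v => Sum.inl (c v), fun {v} => hV.elim v⟩, fun v => hV.elim v⟩
  have hpq : ∀ x, ∃ p q, G.Adj x p ∧ G.Adj x q ∧ p ≠ q := by
    intro x
    have h : 1 < (G.neighborSet x).ncard := by rw [hG]; omega
    obtain ⟨p, hp, q, hq, hne⟩ := (Set.one_lt_ncard (Set.toFinite _)).mp h
    exact ⟨p, q, hp, hq, hne⟩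
  choose p q hp hq hne using hpq
  -- `D` holds the candidates for recoloring. The first kind of edge of `H` protects properness; the
  -- second forces `p x` and `q x` to get different new colors if both are recolored. Vertices `x ∈
  -- D` need no such edge: they have a neighbor in `I`, which is never recolored.
  let D : Set V := {y | y ∉ I ∧ ∃ v ∈ I, G.Adj v y}
  let H : SimpleGraph (V × Bool) :=
    { Adj := fun y z => y.2 = z.2 ∧ y.1 ≠ z.1 ∧ y.1 ∈ D ∧ z.1 ∈ D ∧
        (G.Adj y.1 z.1 ∨ ∃ x, x ∉ D ∧ x ∉ I ∧
          (y.1 = p x ∧ z.1 = q x ∨ y.1 = q x ∧ z.1 = p x))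
      symm := ⟨fun y z h => ⟨h.1.symm, h.2.1.symm, h.2.2.2.1, h.2.2.1,
        h.2.2.2.2.imp (·.symm) fun ⟨x, h1, h2, h3⟩ =>
          ⟨x, h1, h2, h3.symm.imp (fun h => ⟨h.2, h.1⟩) (fun h => ⟨h.2, h.1⟩)⟩⟩⟩
      loopless := ⟨fun _ h => h.2.1 rfl⟩ }
  have hdeg : ∀ w, (H.neighborSet w).ncard ≤ d - 1 := by
    rintro ⟨y, e⟩
    by_cases hy : y ∈ D
    · obtain ⟨v, hv, hvy⟩ := hy.2
      -- Each neighbor `x` of `y` accounts for at most one `H`-neighbor: `x` itself if `x ∈ D`, else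
      -- the partner of `y` in the pair `p x`, `q x`. The neighbor `v ∈ I` accounts for none, whence
      -- `d - 1`.
      let g : V → V × Bool := fun x => (if x ∈ D then x else if y = p x then q x else p x, e)
      have hsub : H.neighborSet (y, e) ⊆ g '' (G.neighborSet y \ {v}) := by
        rintro ⟨z, e'⟩ ⟨he, hyz, -, hz, h⟩
        obtain rfl : e = e' := he
        simp only at hyz hz h
        rcases h with h | ⟨x, hxD, hxI, h⟩
        · refine ⟨z, ⟨h, fun hzv => hz.1 ?_⟩, by simp [g, hz]⟩
          rw [Set.mem_singleton_iff.mp hzv]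
          exact hv
        · have hxv : x ∉ ({v} : Set V) := fun hxv => hxI (by
            rw [Set.mem_singleton_iff.mp hxv]; exact hv)
          rcases h with ⟨rfl, rfl⟩ | ⟨rfl, rfl⟩
          · exact ⟨x, ⟨(hp x).symm, hxv⟩, by simp [g, hxD]⟩
          · exact ⟨x, ⟨(hq x).symm, hxv⟩, by simp [g, hxD, (hne x).symm]⟩
      calc (H.neighborSet (y, e)).ncard ≤ (g '' (G.neighborSet y \ {v})).ncard :=
            Set.ncard_le_ncard hsub
        _ ≤ (G.neighborSet y \ {v}).ncard := Set.ncard_image_le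
        _ = d - 1 := by
            rw [Set.ncard_sdiff_singleton_of_mem (show v ∈ G.neighborSet y from hvy.symm), hG]
    · have : H.neighborSet (y, e) = ∅ :=
        Set.eq_empty_of_forall_notMem fun z hz => hy hz.2.2.1
      simp [this]
  let P : V → Set (V × Bool) := fun v => (G.neighborSet v \ I) ×ˢ Set.univ
  have hPcard : ∀ v, 2 * (d - 1) ≤ (P v).ncard := by
    intro v
    -- Two neighbors of `v` in `I` would share the neighbor `v`.
    have h1 : (G.neighborSet v ∩ I).ncard ≤ 1 :=
      (Set.ncard_le_one (Set.toFinite _)).mpr fun a ha b hb => hI a ha.2 b hb.2 v ha.1.symm hb.1.symm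
    have h2 := Set.ncard_inter_add_ncard_sdiff_eq_ncard (G.neighborSet v) I
    rw [hG] at h2
    have h3 : (P v).ncard = (G.neighborSet v \ I).ncard * 2 := by
      rw [Set.ncard_prod, Set.ncard_univ]; simp
    omega
  obtain ⟨t, htP, htI⟩ := exists_indepTransversal H (d - 1) (by omega) hdeg I.toFinset P
    (by
      intro u hu v hv w hwu hwv
      exact hI u (by simpa using hu) v (by simpa using hv) w.1 hwu.1.1 hwv.1.1)
    (fun v _ => hPcard v) fun v => (v, true)
  have htA : ∀ v ∈ I, G.Adj v (t v).1 := fun v hv => (htP v (by simpa using hv)).1.1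
  have htD : ∀ v ∈ I, (t v).1 ∈ D := fun v hv =>
    ⟨(htP v (by simpa using hv)).1.2, v, hv, htA v hv⟩
  have htH : ∀ u ∈ I, ∀ v ∈ I, u ≠ v → ¬ H.Adj (t u) (t v) := fun u hu v hv =>
    htI u (by simpa using hu) v (by simpa using hv)
  let col : V → α ⊕ Bool := fun y =>
    if h : ∃ v ∈ I, (t v).1 = y then Sum.inr (t h.choose).2 else Sum.inl (c y)
  have hcol : ∀ y, (col y = Sum.inl (c y) ∧ ¬ ∃ v ∈ I, (t v).1 = y) ∨
      ∃ v ∈ I, (t v).1 = y ∧ col y = Sum.inr (t v).2 := by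
    intro y
    by_cases h : ∃ v ∈ I, (t v).1 = y
    · exact Or.inr ⟨h.choose, h.choose_spec.1, h.choose_spec.2, by simp only [col]; rw [dif_pos h]⟩
    · exact Or.inl ⟨by simp only [col]; rw [dif_neg h], h⟩
  have hproper : ∀ {y z}, G.Adj y z → col y ≠ col z := by
    intro y z hyz heq
    rcases hcol y with ⟨hy, -⟩ | ⟨u, hu, hy, hcy⟩ <;>
      rcases hcol z with ⟨hz, -⟩ | ⟨v, hv, hz, hcz⟩
    · rw [hy, hz] at heq
      exact c.valid hyz (Sum.inl_injective heq)
    · rw [hy, hcz] at heq; cases heq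
    · rw [hcy, hz] at heq; cases heq
    · rw [hcy, hcz] at heq
      subst hy hz
      refine htH u hu v hv (fun h => ?_)
        ⟨Sum.inr_injective heq, hyz.ne, htD u hu, htD v hv, Or.inl hyz⟩
      subst h
      exact hyz.ne rfl
  refine ⟨⟨col, fun h => hproper h⟩, fun v hv => ?_⟩
  rw [mem_badVertices_iff] at hv
  obtain ⟨hv2, hv⟩ := hv
  replace hv : ∀ x y, G.Adj v x → G.Adj v y → col x = col y := hv
  have hvI : v ∉ I := by
    intro hvI
    -- For `v ∈ I`, the only recolored neighbor is `(t v).1`; any other keeps an old color.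
    have huniq : ∀ z, G.Adj v z → z = (t v).1 := by
      intro z hz
      have h1 := hv z (t v).1 hz (htA v hvI)
      rcases hcol (t v).1 with ⟨-, h⟩ | ⟨u, hu, -, hc⟩
      · exact (h ⟨v, hvI, rfl⟩).elim
      rcases hcol z with ⟨h, -⟩ | ⟨w, hw, rfl, -⟩
      · rw [h, hc] at h1; cases h1
      · rw [hI v hvI w hw _ hz (htA w hw)]
    exact hne v ((huniq _ (hp v)).trans (huniq _ (hq v)).symm)
  refine ⟨(mem_badVertices_iff c v).mpr ⟨hv2, ?_⟩, hvI⟩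
  -- If all neighbors of `v` are recolored, `H` separates `p v` from `q v`; if one keeps its old
  -- color, all do, and `v` was already bad under `c`.
  by_cases hall : ∀ y, G.Adj v y → ∃ u ∈ I, (t u).1 = y ∧ col y = Sum.inr (t u).2
  · exfalso
    have hvD : v ∉ D := by
      rintro ⟨-, w, hw, hwv⟩
      obtain ⟨u, hu, rfl, -⟩ := hall w hwv.symm
      exact (htD u hu).1 hw
    obtain ⟨u, hu, hup, huc⟩ := hall _ (hp v)
    obtain ⟨w, hw, hwq, hwc⟩ := hall _ (hq v)
    have heq := hv _ _ (hp v) (hq v)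
    rw [huc, hwc] at heq
    refine htH u hu w hw (fun h => ?_) ⟨Sum.inr_injective heq, ?_, htD u hu, htD w hw,
      Or.inr ⟨v, hvD, hvI, Or.inl ⟨hup, hwq⟩⟩⟩
    · subst h
      exact hne v (hup.symm.trans hwq)
    · rw [hup, hwq]
      exact hne v
  · push Not at hall
    obtain ⟨y, hy, hyc⟩ := hall
    have hyl : col y = Sum.inl (c y) := by
      rcases hcol y with h | ⟨u, hu, h1, h2⟩
      · exact h.1
      · exact (hyc u hu h1 h2).elim
    have hl : ∀ z, G.Adj v z → c z = c y := by
      intro z hz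
      have h1 := hv z y hz hy
      rw [hyl] at h1
      rcases hcol z with h | ⟨u, -, -, h⟩
      · rw [h.1] at h1
        exact Sum.inl_injective h1
      · rw [h] at h1; cases h1
    intro x z hx hz
    rw [hl x hx, hl z hz]

/-! ### Iterating over the classes -/

theorem badVertices_comp_injective {V α β : Type*} {G : SimpleGraph V} (c : G.Coloring α)
    (f : α ↪ β) : badVertices ((Embedding.completeGraph f).toHom.comp c) = badVertices c := by
  ext v
  simp only [mem_badVertices_iff]
  refine and_congr_right fun _ => forall₄_congr fun x y _ _ => ?_
  exact f.injective.eq_iff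

/-- If the bad vertices of a `k`-coloring of a regular graph split into `n` classes with pairwise
disjoint neighborhoods inside each class, then `k + 2n` colors suffice for a coloring without bad
vertices. -/
theorem exists_coloring_badVertices_eq_empty {V : Type*} [Finite V] {G : SimpleGraph V}
    {d : ℕ} (hd : 2 ≤ d) (hG : ∀ v, (G.neighborSet v).ncard = d) (f : V → ℕ) (n : ℕ) :
    ∀ (k : ℕ) (c : G.Coloring (Fin k)), (∀ v ∈ badVertices c, f v < n) →
      (∀ u ∈ badVertices c, ∀ v ∈ badVertices c, f u = f v →
        ∀ w, G.Adj u w → G.Adj v w → u = v) →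
      ∃ c' : G.Coloring (Fin (k + 2 * n)), badVertices c' = ∅ := by
  induction n with
  | zero =>
    intro k c hlt _
    exact ⟨c, Set.eq_empty_of_forall_notMem fun v hv => by simpa using hlt v hv⟩
  | succ n ih =>
    intro k c hlt hdisj
    obtain ⟨c₁, hc₁⟩ := exists_coloring_badVertices_subset_diff hd hG c
      {v | v ∈ badVertices c ∧ f v = n}
      (fun u hu v hv => hdisj u hu.1 v hv.1 (hu.2.trans hv.2.symm))
    let e : Fin k ⊕ Bool ≃ Fin (k + 2) :=
      (Equiv.sumCongr (Equiv.refl _) finTwoEquiv.symm).trans finSumFinEquiv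
    let c₂ : G.Coloring (Fin (k + 2)) := (Embedding.completeGraph e.toEmbedding).toHom.comp c₁
    have hc₂ : badVertices c₂ = badVertices c₁ := badVertices_comp_injective c₁ e.toEmbedding
    have hsub : ∀ v ∈ badVertices c₂, v ∈ badVertices c ∧ f v ≠ n := fun v hv => by
      rw [hc₂] at hv
      have := hc₁ hv
      exact ⟨this.1, fun h => this.2 ⟨this.1, h⟩⟩
    have := ih (k + 2) c₂
      (fun v hv => lt_of_le_of_ne (Nat.le_of_lt_succ (hlt v (hsub v hv).1)) (hsub v hv).2)
      (fun u hu v hv => hdisj u (hsub u hu).1 v (hsub v hv).1)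
    rwa [show k + 2 * (n + 1) = k + 2 + 2 * n by ring]

theorem dynamicChromaticNumber_two_le {V : Type*} [Finite V] (G : SimpleGraph V)
    {d : ℕ} (hG : ∀ v, (G.neighborSet v).ncard = d) (k : ℕ) (c : G.Coloring (Fin k)) :
    G.dynamicChromaticNumber 2 ≤
      (k : ℕ∞) + 2 * (G.squareInduceDiff (badVertices c)).chromaticNumber := by
  classical
  have hle : ∀ {m : ℕ} (c' : G.Coloring (Fin m)), badVertices c' = ∅ →
      G.dynamicChromaticNumber 2 ≤ m := fun {m} c' hc' =>
    iInf₂_le m ⟨c', isDynamicColoring_two_of_badVertices_eq_empty c' hc'⟩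
  rcases lt_or_ge d 2 with hd | hd
  -- Degrees below two leave no bad vertices.
  · refine (hle c (Set.eq_empty_of_forall_notMem fun v hv => ?_)).trans le_self_add
    have := hv.1
    rw [← (Set.toFinite _).cast_ncard_eq, hG] at this
    have : 2 ≤ d := by exact_mod_cast this
    omega
  obtain ⟨n, hn⟩ : ∃ n : ℕ, (G.squareInduceDiff (badVertices c)).chromaticNumber = n := by
    have := Fintype.ofFinite (badVertices c)
    exact ENat.ne_top_iff_exists.mp (chromaticNumber_ne_top_iff_exists.mpr
      ⟨_, colorable_of_fintype _⟩) |>.imp fun _ h => h.symm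
  obtain ⟨C⟩ : (G.squareInduceDiff (badVertices c)).Colorable n :=
    chromaticNumber_le_iff_colorable.mp hn.le
  obtain ⟨c', hc'⟩ := exists_coloring_badVertices_eq_empty hd hG
    -- The value `0` off the bad set is never used.
    (fun v => if h : v ∈ badVertices c then (C ⟨v, h⟩ : ℕ) else 0) n k c
    (fun v hv => by simp [hv])
    (by
      intro u hu v hv huv w huw hvw
      simp only [hu, hv, dif_pos] at huv
      by_contra hne
      refine C.valid (v := ⟨u, hu⟩) (w := ⟨v, hv⟩) ⟨⟨hne, Or.inr ⟨w, huw, hvw.symm⟩⟩, ?_⟩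
        (Fin.ext huv)
      intro hadj
      have hadj : G.Adj u v := hadj
      exact c.valid hvw (((mem_badVertices_iff c u).mp hu).2 v w hadj huw))
  rw [hn]
  exact_mod_cast hle c' hc'

end SimpleGraph

theorem mainTheorem2 {V : Type*} [Finite V] (G : SimpleGraph V) [G.LocallyFinite]
    (d : ℕ) (hG : G.IsRegularOfDegree d) :
    (∀ (k : ℕ) (c : G.Coloring (Fin k)),
      G.dynamicChromaticNumber 2 ≤
        (k : ℕ∞) + 2 * (G.squareInduceDiff (SimpleGraph.badVertices c)).chromaticNumber) ∧
    ∃ m : ℕ∞,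
      IsLeast {n : ℕ∞ | ∃ (k : ℕ) (c : G.Coloring (Fin k)),
        n = (k : ℕ∞) + 2 * (G.squareInduceDiff (SimpleGraph.badVertices c)).chromaticNumber} m ∧
      G.dynamicChromaticNumber 2 ≤ m := by
  have hcard : ∀ v, (G.neighborSet v).ncard = d := fun v => by
    rw [← hG v, Set.ncard_eq_toFinset_card', ← SimpleGraph.card_neighborSet_eq_degree,
      Set.toFinset_card]
  have hmain := fun k c => SimpleGraph.dynamicChromaticNumber_two_le G hcard k c
  refine ⟨hmain, ?_⟩
  have hne : {n : ℕ∞ | ∃ (k : ℕ) (c : G.Coloring (Fin k)),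
      n = (k : ℕ∞) +
        2 * (G.squareInduceDiff (SimpleGraph.badVertices c)).chromaticNumber}.Nonempty := by
    have := Fintype.ofFinite V
    obtain ⟨c⟩ := G.colorable_of_fintype
    exact ⟨_, _, c, rfl⟩
  refine ⟨sInf _, ⟨csInf_mem hne, fun n hn => sInf_le hn⟩, ?_⟩
  obtain ⟨k, c, hkc⟩ := csInf_mem hne
  rw [hkc]
  exact hmain k c
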